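/- Call a complex $n\times n$ matrix $H$ a Hadamard matrix if it is unitary ($HH^*=H^*H=I_n$) and every entry has modulus $\frac{1}{\sqrt n}$; it is in dephased form if all entries of its first row and of its first column are equal to $\frac{1}{\sqrt n}$. Two complex $n\times n$ matrices are spectrally equivalent if they have the same eigenvalues, counted with (algebraic) multiplicity. If $A$ and $B$ are two $5\times 5$ Hadamard matrices in dephased form and $\operatorname{tr}(A)=\operatorname{tr}(B)$, then $A$ and $B$ are spectrally equivalent. -/

import Mathlib

/-- An `n × n` (complex) Hadamard matrix: a unitary matrix all of whose entries have
modulus `1 / √n`. -/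
def IsHadamard {n : ℕ} (H : Matrix (Fin n) (Fin n) ℂ) : Prop :=
  H * H.conjTranspose = 1 ∧ H.conjTranspose * H = 1 ∧ ∀ i j, ‖H i j‖ = 1 / Real.sqrt n

/-- A matrix is in dephased form if all entries of its first row and of its first column
(those with index `0`) are equal to `1 / √n`. -/
def IsDephased {n : ℕ} [NeZero n] (H : Matrix (Fin n) (Fin n) ℂ) : Prop :=
  (∀ j, H 0 j = ((1 / Real.sqrt n : ℝ) : ℂ)) ∧ (∀ i, H i 0 = ((1 / Real.sqrt n : ℝ) : ℂ))

/-- Two complex matrices are spectrally equivalent if their spectra are equal including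
multiplicity: they have the same multiset of eigenvalues, i.e. of roots of the
characteristic polynomial. -/
def SpectrallyEquivalent {n : ℕ} (A B : Matrix (Fin n) (Fin n) ℂ) : Prop :=
  A.charpoly.roots = B.charpoly.roots

/-! Scale by `√5` and let `a` be the entrywise ratio of two distinct rows: five unit numbers with
sum `0`. The crux is that their squares also sum to `0` (`sum_ratio_sq_eq_zero`). Then `∏ (X - a j)
= X ^ 5 - c`, so `a` is a regular pentagon, and the entries of a dephased matrix are `ψ (f i j)` for
the standard character `ψ` of `ZMod 5`. Differences of distinct rows of `f` are bijective, which
forces `f i j = r i * τ j`; relabelling both indices by `r` gives `permFourier u`. Its trace is a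
multiple of `∑ ψ (x * u x)`, hence determines how often `x * u x` takes each value. These counts
determine `u` up to dilation, which is a permutation similarity of the matrix, and inversion, which
is a transposition up to relabelling. Both preserve the characteristic polynomial.

For the crux, put the first two rows in the form `1, a` and study the unitary `M = H D H* / 5` with
`D = diagonal a`. The diagonals of `M`, `M ^ 2`, `M ^ 3` are constant: `0`, `s`, `3 w`. If `s ≠ 0`,
unitarity forces `s ^ 3 = -2 w ^ 2` and `|s| = 1/2` (`shift_relation`). Then `a` takes three values,
with multiplicities `1, 2, 2`, and two columns on which `a` agrees cannot be orthogonal. -/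

/-! ### Unitary matrices with zero diagonal -/

-- Expanding `|a + b|²` gives `Re (a * conj b) = -1/64`, already the full modulus of `a * conj b`.
-- So `a` and `b` are real multiples of their sum.
open ComplexConjugate in
theorem eq_real_smul_of_add_eq {a b s : ℂ} {X Y : ℝ} (hs : Complex.normSq s = 1 / 4)
    (hab : a + b = -s / 4) (ha : Complex.normSq a = X / 16) (hb : Complex.normSq b = Y / 16)
    (hXY : X * Y = 1 / 16) (hadd : X + Y = 3 / 4) : b = -s * ((Y - 1 / 4 : ℝ) : ℂ) := by
  have hsum : Complex.normSq (a + b) = 1 / 64 := by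
    rw [hab, show -s / 4 = (-1 / 4 : ℝ) * s by push_cast; ring, Complex.normSq_mul,
      Complex.normSq_ofReal, hs]
    norm_num
  have hre : (a * conj b).re = -1 / 64 := by
    rw [Complex.normSq_add, ha, hb] at hsum
    linarith
  have him : (a * conj b).im = 0 := by
    have h1 : Complex.normSq (a * conj b) = (1 / 64) ^ 2 := by
      rw [Complex.normSq_mul, Complex.normSq_conj, ha, hb]
      linear_combination hXY / 256
    rw [Complex.normSq_apply, hre] at h1
    nlinarith
  have hc : a * conj b = ((-1 / 64 : ℝ) : ℂ) := Complex.ext (by simpa using hre) (by simpa using him)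
  have hbb : b * conj b = ((Y / 16 : ℝ) : ℂ) := by rw [Complex.mul_conj, hb]
  have hss : s * conj s = ((1 / 4 : ℝ) : ℂ) := by rw [Complex.mul_conj, hs]
  have h2 : -s / 4 * conj b = ((Y / 16 - 1 / 64 : ℝ) : ℂ) := by
    rw [← hab, add_mul, hc, hbb]; push_cast; ring
  have h3 : -conj s / 4 * b = ((Y / 16 - 1 / 64 : ℝ) : ℂ) := by
    have := congrArg conj h2
    simpa [Complex.conj_ofReal, map_ofNat] using this
  push_cast at *
  linear_combination (-16 * s) * h3 - 4 * b * hss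

/-- Squared moduli `P`, `Q`, `N` of the entries of a unitary matrix `[s P; Q N]`, where `N` is `3 × 3` with zero
diagonal: those of row `2` are determined by the products of opposite entries. -/
theorem moduli_row {h P2 P3 P4 Q2 Q3 Q4 N23 N24 N32 N34 N42 N43 : ℝ} (hh : 0 < h)
    (hPQ2 : P2 * Q2 = h ^ 2) (hPQ3 : P3 * Q3 = h ^ 2) (hPQ4 : P4 * Q4 = h ^ 2)
    (hN23 : N23 * N32 = h ^ 2) (hN24 : N24 * N42 = h ^ 2) (hN34 : N34 * N43 = h ^ 2)
    (hP2 : 0 ≤ P2) (hP3 : 0 ≤ P3) (hP4 : 0 ≤ P4)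
    (h23 : 0 ≤ N23) (h24 : 0 ≤ N24)
    (q23 : Q2 * Q3 = N24 * N34) (q24 : Q2 * Q4 = N23 * N43)
    (p34 : P3 * P4 = N23 * N24)
    (row : Q2 + N23 + N24 = 1) (col : P2 + N32 + N42 = 1) :
    Q2 = h ∧ N23 * N24 = h ^ 2 := by
  have hh2 : (0 : ℝ) < h ^ 2 := by positivity
  have pos : ∀ {x y : ℝ}, 0 ≤ x → x * y = h ^ 2 → 0 < x := fun {x y} hx hxy =>
    lt_of_le_of_ne hx fun h0 => by rw [← h0, zero_mul] at hxy; exact hh2.ne hxy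
  have hP2' := pos hP2 hPQ2
  have hP3' := pos hP3 hPQ3
  have hP4' := pos hP4 hPQ4
  have hN23' := pos h23 hN23
  have hN24' := pos h24 hN24
  have hQ : ∀ {x y : ℝ}, 0 < x → x * y = h ^ 2 → 0 < y := fun {x y} hx hxy =>
    pos_of_mul_pos_right (hxy ▸ hh2) hx.le
  have hQ2' := hQ hP2' hPQ2
  have hQ3' := hQ hP3' hPQ3
  have hQ4' := hQ hP4' hPQ4
  -- The orthogonality relations fix the product of the `Q`s. This expresses `N23 * N24` and `N32 *
  -- N42` by `Q2` and `P2`, so that the norms of the row and the column give two equations that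
  -- `hN23` and `hN24` turn into one another.
  have e1 : (Q2 * Q3 * Q4) ^ 2 = (h ^ 3) ^ 2 := by
    have e : Q2 ^ 2 * (Q3 * Q4) = h ^ 2 * (P3 * P4) := by
      linear_combination Q2 * Q4 * q23 + N24 * N34 * q24 + N24 * N23 * hN34 - h ^ 2 * p34
    linear_combination (Q3 * Q4) * e + h ^ 2 * P4 * Q4 * hPQ3 + h ^ 4 * hPQ4
  have e2 : Q2 * Q3 * Q4 = h ^ 3 := by
    rwa [sq_eq_sq₀ (by positivity) (by positivity)] at e1
  have e3 : N23 * N24 = h * Q2 := by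
    have : h ^ 3 * (P3 * P4) = h ^ 3 * (h * Q2) := by
      linear_combination (-P3 * P4) * e2 + Q2 * P4 * Q4 * hPQ3 + h ^ 2 * Q2 * hPQ4
    rw [← p34]
    exact mul_left_cancel₀ (by positivity) this
  have e4 : N32 * N42 = h * P2 := by
    have : (N23 * N24) * (N32 * N42) = (N23 * N24) * (h * P2) := by
      linear_combination N24 * N42 * hN23 + h ^ 2 * hN24 - h * P2 * e3 - h ^ 2 * hPQ2
    exact mul_left_cancel₀ (by positivity) this
  have e5 : (N23 + h) * (N24 + h) = h + h ^ 2 := by linear_combination e3 + h * row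
  have e6 : (N32 + h) * (N42 + h) = h + h ^ 2 := by linear_combination e4 + h * col
  have e7 : N23 * N24 = h ^ 2 := by
    have : (h + h ^ 2) * (N23 * N24) = (h + h ^ 2) * h ^ 2 := by
      linear_combination (-N23 * N24) * e6 + h ^ 2 * e5 +
        (N24 * (N42 + h)) * hN23 + (h * (N23 + h)) * hN24
    exact mul_left_cancel₀ (by positivity) this
  refine ⟨?_, e7⟩
  have : h * Q2 = h * h := by rw [← e3, e7]; ring
  exact mul_left_cancel₀ hh.ne' this

open ComplexConjugate in
/-- The corner entry of a unitary matrix `[s p; q N]`, where `N` is `3 × 3` with zero diagonal and opposite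
entries have products `w` and `s / 2`. -/
theorem block_relation {s p2 p3 p4 q2 q3 q4 n23 n24 n32 n34 n42 n43 w : ℂ} (hs : s ≠ 0)
    (hw2 : p2 * q2 = w) (hw3 : p3 * q3 = w) (hw4 : p4 * q4 = w)
    (hn23 : n23 * n32 = s / 2) (hn24 : n24 * n42 = s / 2) (hn34 : n34 * n43 = s / 2)
    (q23 : q2 * conj q3 + n24 * conj n34 = 0) (q24 : q2 * conj q4 + n23 * conj n43 = 0)
    (q34 : q3 * conj q4 + n32 * conj n42 = 0)
    (p23 : p2 * conj p3 + n42 * conj n43 = 0) (p24 : p2 * conj p4 + n32 * conj n34 = 0)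
    (p34 : p3 * conj p4 + n23 * conj n24 = 0)
    (r2 : q2 * conj q2 + n23 * conj n23 + n24 * conj n24 = 1)
    (r3 : q3 * conj q3 + n32 * conj n32 + n34 * conj n34 = 1)
    (r4 : q4 * conj q4 + n42 * conj n42 + n43 * conj n43 = 1)
    (c2 : p2 * conj p2 + n32 * conj n32 + n42 * conj n42 = 1)
    (c3 : p3 * conj p3 + n23 * conj n23 + n43 * conj n43 = 1)
    (c4 : p4 * conj p4 + n24 * conj n24 + n34 * conj n34 = 1)
    (c0 : s * conj s + q2 * conj q2 + q3 * conj q3 + q4 * conj q4 = 1)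
    (o2 : s * conj q2 + p3 * conj n23 + p4 * conj n24 = 0)
    (o3 : s * conj q3 + p2 * conj n32 + p4 * conj n34 = 0) :
    s ^ 3 = -2 * w ^ 2 ∧ Complex.normSq s = 1 / 4 := by
  obtain ⟨h, hh, hS⟩ : ∃ h : ℝ, 0 < h ∧ Complex.normSq s = 4 * h ^ 2 :=
    ⟨‖s‖ / 2, by positivity, by rw [Complex.normSq_eq_norm_sq]; ring⟩
  have hW : Complex.normSq w = h ^ 2 := by
    have : w * conj w = (s / 2) * conj (s / 2) := by
      have e : w * conj w = (p2 * conj p3) * (q2 * conj q3) := by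
        rw [← hw2]; nth_rw 2 [hw2]; rw [← hw3, map_mul]; ring
      rw [e, eq_neg_of_add_eq_zero_left p23, eq_neg_of_add_eq_zero_left q23, ← hn24]
      nth_rw 2 [hn24]; rw [← hn34, map_mul]; ring
    rw [Complex.mul_conj, Complex.mul_conj, Complex.ofReal_inj, Complex.normSq_div, hS] at this
    rw [this]; norm_num [Complex.normSq_apply]
  have hHalf : Complex.normSq (s / 2) = h ^ 2 := by
    rw [Complex.normSq_div, hS]; norm_num [Complex.normSq_apply]
  have N := fun {x y z : ℂ} (e : x * y = z) => show Complex.normSq x * Complex.normSq y =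
    Complex.normSq z by rw [← Complex.normSq_mul, e]
  have O := fun {x y z t : ℂ} (e : x * conj y + z * conj t = 0) =>
    show Complex.normSq x * Complex.normSq y = Complex.normSq z * Complex.normSq t by
      rw [← Complex.normSq_conj y, ← Complex.normSq_mul, eq_neg_of_add_eq_zero_left e,
        Complex.normSq_neg, Complex.normSq_mul, Complex.normSq_conj]
  have R := fun {x y z : ℂ} (e : x * conj x + y * conj y + z * conj z = 1) =>
    show Complex.normSq x + Complex.normSq y + Complex.normSq z = 1 by
      simp only [Complex.mul_conj] at e; exact_mod_cast e
  have hP2 := hW ▸ N hw2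
  have hP3 := hW ▸ N hw3
  have hP4 := hW ▸ N hw4
  have hN23 := hHalf ▸ N hn23
  have hN24 := hHalf ▸ N hn24
  have hN34 := hHalf ▸ N hn34
  have n0 := Complex.normSq_nonneg
  obtain ⟨Q2, N2⟩ := moduli_row hh hP2 hP3 hP4 hN23 hN24 hN34 (n0 _) (n0 _) (n0 _) (n0 _) (n0 _)
    (O q23) (O q24) (O p34) (R r2) (R c2)
  obtain ⟨Q3, N3⟩ := moduli_row (N32 := Complex.normSq n23) (N42 := Complex.normSq n43)
    (N24 := Complex.normSq n34) (N34 := Complex.normSq n24) (N43 := Complex.normSq n42)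
    hh hP3 hP2 hP4 (by rw [mul_comm, hN23]) hN34 hN24
    (n0 _) (n0 _) (n0 _) (n0 _) (n0 _)
    (by rw [mul_comm, O q23, mul_comm]) (O q34) (O p24) (R r3) (R c3)
  obtain ⟨Q4, N4⟩ := moduli_row (N32 := Complex.normSq n24) (N42 := Complex.normSq n34)
    (N24 := Complex.normSq n43) (N34 := Complex.normSq n23) (N43 := Complex.normSq n32)
    hh hP4 hP2 hP3 (by rw [mul_comm, hN24]) (by rw [mul_comm, hN34]) hN23
    (n0 _) (n0 _) (n0 _) (n0 _) (n0 _)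
    (by rw [mul_comm, O q24, mul_comm]) (by rw [mul_comm, O q34, mul_comm]) (O p23) (R r4) (R c4)
  have hC : Complex.normSq s + Complex.normSq q2 + Complex.normSq q3 + Complex.normSq q4 = 1 := by
    simp only [Complex.mul_conj] at c0; exact_mod_cast c0
  -- The norm of the first column now reads `4 h ^ 2 + 3 h = 1`.
  obtain rfl : h = 1 / 4 := by
    rw [hS, Q2, Q3, Q4] at hC
    have : (h - 1 / 4) * (h + 1) = 0 := by linear_combination hC / 4
    rcases mul_eq_zero.1 this with h1 | h1 <;> linarith
  have hS' : Complex.normSq s = 1 / 4 := by rw [hS]; norm_num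
  refine ⟨?_, hS'⟩
  have P4' : Complex.normSq p4 = 1 / 4 := by rw [Q4] at hP4; linarith
  have P3' : Complex.normSq p3 = 1 / 4 := by rw [Q3] at hP3; linarith
  have P2' : Complex.normSq p2 = 1 / 4 := by rw [Q2] at hP2; linarith
  have hN23pos : Complex.normSq n23 ≠ 0 := fun e => by rw [e] at hN23; norm_num at hN23
  have hN24_32 : Complex.normSq n32 = Complex.normSq n24 :=
    mul_left_cancel₀ hN23pos (by rw [hN23, N2])
  have hR2 := R r2
  have hR3 := R r3
  rw [Q2] at hR2
  rw [Q3] at hR3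
  have hsum2 : Complex.normSq n23 + Complex.normSq n24 = 3 / 4 := by linarith
  have hsum3 : Complex.normSq n34 + Complex.normSq n32 = 3 / 4 := by linarith
  have hq2 : q2 * conj q2 = 1 / 4 := by rw [Complex.mul_conj, Q2]; norm_num
  have hq3 : q3 * conj q3 = 1 / 4 := by rw [Complex.mul_conj, Q3]; norm_num
  have T := fun {x y z : ℂ} (hx : Complex.normSq x = 1 / 4) (hy : Complex.normSq y = 1 / 4) =>
    show Complex.normSq (x * y * conj z) = Complex.normSq z / 16 by
      rw [Complex.normSq_mul, Complex.normSq_mul, Complex.normSq_conj, hx, hy]; ring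
  have s2 : q2 * p3 * conj n23 + q2 * p4 * conj n24 = -s / 4 := by
    linear_combination q2 * o2 - s * hq2
  have s3 : q3 * p4 * conj n34 + q3 * p2 * conj n32 = -s / 4 := by
    linear_combination q3 * o3 - s * hq3
  have A := eq_real_smul_of_add_eq hS' ((add_comm _ _).trans s2) (T Q2 P4') (T Q2 P3')
    (by rw [mul_comm, N2]; norm_num) (by rw [add_comm, hsum2])
  have B := eq_real_smul_of_add_eq hS' s3 (T Q3 P4') (T Q3 P2')
    (by rw [mul_comm, N3]; norm_num) hsum3
  -- The two factors are real multiples of `s` by `A` and `B`, while opposite entries pair up to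
  -- `w`, `w` and `s / 2`. Comparing both values yields the cubic relation.
  have hK : (q2 * p3 * conj n23) * (q3 * p2 * conj n32) = w ^ 2 * conj (s / 2) := by
    rw [← hn23, map_mul]
    linear_combination (p3 * q3 * conj n23 * conj n32) * hw2 + (w * conj n23 * conj n32) * hw3
  have hxy : ((Complex.normSq n23 - 1 / 4) * (Complex.normSq n32 - 1 / 4) : ℝ) = -1 / 16 := by
    rw [hN24_32]; linear_combination N2 - hsum2 / 4
  have hss : s * conj s = 1 / 4 := by rw [Complex.mul_conj, hS']; norm_num
  rw [A, B] at hK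
  have hxy' : ((Complex.normSq n23 - 1 / 4 : ℝ) : ℂ) * ((Complex.normSq n32 - 1 / 4 : ℝ) : ℂ)
      = -1 / 16 := by rw [← Complex.ofReal_mul, hxy]; norm_num
  have h2 : conj (s / 2) = conj s / 2 := by simp [map_ofNat]
  rw [h2] at hK
  linear_combination (-16 * s) * hK + 16 * s ^ 3 * hxy' - 8 * w ^ 2 * hss

open ComplexConjugate in
/-- A unitary matrix with zero diagonal and `M 0 1 = 1` whose square and cube have constant diagonal. -/
theorem shift_relation {M : Matrix (Fin 5) (Fin 5) ℂ} (h1 : M * M.conjTranspose = 1)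
    (h2 : M.conjTranspose * M = 1) (hd : ∀ i, M i i = 0) (h01 : M 0 1 = 1)
    (hsq : ∀ i, (M * M) i i = (M * M) 0 0) (hcu : ∀ i, (M * M * M) i i = (M * M * M) 0 0)
    (hs : (M * M) 0 0 ≠ 0) :
    ∃ w, (M * M * M) 0 0 = 3 * w ∧ ((M * M) 0 0) ^ 3 = -2 * w ^ 2 ∧
      Complex.normSq ((M * M) 0 0) = 1 / 4 := by
  have R : ∀ i k, M i 0 * conj (M k 0) + M i 1 * conj (M k 1) + M i 2 * conj (M k 2) +
      M i 3 * conj (M k 3) + M i 4 * conj (M k 4) = if i = k then 1 else 0 := fun i k => by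
    have := congrFun (congrFun h1 i) k
    simpa [Matrix.mul_apply, Fin.sum_univ_five, Matrix.one_apply] using this
  have C : ∀ i k, conj (M 0 i) * M 0 k + conj (M 1 i) * M 1 k + conj (M 2 i) * M 2 k +
      conj (M 3 i) * M 3 k + conj (M 4 i) * M 4 k = if i = k then 1 else 0 := fun i k => by
    have := congrFun (congrFun h2 i) k
    simpa [Matrix.mul_apply, Fin.sum_univ_five, Matrix.one_apply] using this
  have z : ∀ {x y z : ℂ}, x * conj x + y * conj y + z * conj z = 0 → x = 0 ∧ y = 0 ∧ z = 0 := by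
    intro x y z h
    simp only [Complex.mul_conj] at h
    have h' : Complex.normSq x + Complex.normSq y + Complex.normSq z = 0 := by exact_mod_cast h
    have := Complex.normSq_nonneg x
    have := Complex.normSq_nonneg y
    have := Complex.normSq_nonneg z
    refine ⟨?_, ?_, ?_⟩ <;> rw [← Complex.normSq_eq_zero] <;> linarith
  have d0 := hd 0
  have d1 := hd 1
  have d2 := hd 2
  have d3 := hd 3
  have d4 := hd 4
  obtain ⟨a2, a3, a4⟩ := z (x := M 0 2) (y := M 0 3) (z := M 0 4) (by
    have := R 0 0
    simp only [d0, h01, map_one, map_zero, if_true] at this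
    linear_combination this)
  obtain ⟨b2, b3, b4⟩ := z (x := M 2 1) (y := M 3 1) (z := M 4 1) (by
    have := C 1 1
    simp only [d1, h01, map_one, map_zero, if_true] at this
    linear_combination this)
  have hM2 : (M * M) 0 0 = M 1 0 := by
    simp [Matrix.mul_apply, Fin.sum_univ_five, d0, h01, a2, a3, a4]
  have s2 := hsq 2
  have s3 := hsq 3
  have s4 := hsq 4
  have t1 := hcu 1
  have t2 := hcu 2
  have t3 := hcu 3
  have t4 := hcu 4
  rw [hM2] at s2 s3 s4 hs
  rw [hM2]
  simp only [Matrix.mul_apply, Fin.sum_univ_five, d0, d1, d2, d3, d4, h01, a2, a3, a4, b2, b3, b4,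
    zero_mul, mul_zero, zero_add, add_zero, one_mul] at s2 s3 s4 t1 t2 t3 t4 ⊢
  -- The diagonal entries of `M ^ 3` at `2, 3, 4` share the two 3-cycles through `2, 3, 4` and
  -- otherwise differ only in these products.
  have w3 : M 1 3 * M 3 0 = M 1 2 * M 2 0 := by linear_combination t3 - t2
  have w4 : M 1 4 * M 4 0 = M 1 2 * M 2 0 := by linear_combination t4 - t2
  refine ⟨M 1 2 * M 2 0, by linear_combination w3 + w4, ?_⟩
  have row23 := R 2 3
  have row24 := R 2 4
  have row34 := R 3 4
  have col32 := C 3 2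
  have col42 := C 4 2
  have col43 := C 4 3
  have row22 := R 2 2
  have row33 := R 3 3
  have row44 := R 4 4
  have col22 := C 2 2
  have col33 := C 3 3
  have col44 := C 4 4
  have col00 := C 0 0
  have row12 := R 1 2
  have row13 := R 1 3
  simp only [d2, d3, d4, b2, b3, b4, map_zero, mul_zero, zero_mul, add_zero,
    Fin.reduceEq, reduceIte] at row23 row24 row34 row22 row33 row44 row12 row13
  simp only [d0, d2, d3, d4, a2, a3, a4, map_zero, mul_zero, zero_mul, add_zero, zero_add,
    Fin.reduceEq, reduceIte] at col32 col42 col43 col22 col33 col44 col00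
  -- The three products of opposite entries of the block have pairwise sums `s`, so each is `s / 2`.
  refine block_relation hs rfl w3 w4 (n23 := M 2 3) (n24 := M 2 4) (n32 := M 3 2) (n34 := M 3 4)
    (n42 := M 4 2) (n43 := M 4 3) (by linear_combination (s2 + s3 - s4) / 2)
    (by linear_combination (s2 + s4 - s3) / 2) (by linear_combination (s3 + s4 - s2) / 2)
    (by linear_combination row23)
    (by linear_combination row24)
    (by linear_combination row34)
    (by linear_combination col32)
    (by linear_combination col42)
    (by linear_combination col43)
    (by linear_combination row22)
    (by linear_combination row33)
    (by linear_combination row44)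
    (by linear_combination col22)
    (by linear_combination col33)
    (by linear_combination col44)
    (by linear_combination col00)
    (by linear_combination row12)
    (by linear_combination row13)

/-! ### Unit numbers determined by their power sums -/

-- Newton's identities express `e2` and `e3` by power sums. Since conjugation inverts each `a j`,
-- one has `e4 = e5 * conj e1 = 0` and `e3 = e5 * conj e2`.
open ComplexConjugate Polynomial in
theorem prod_X_sub_C_of_sum_eq_zero {a : Fin 5 → ℂ} (ha : ∀ j, a j * conj (a j) = 1)
    (h1 : ∑ j, a j = 0) :
    ∏ j, (X - C (a j)) = X ^ 5 - C ((∑ j, a j ^ 2) / 2) * X ^ 3 - C ((∑ j, a j ^ 3) / 3) * X ^ 2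
      - C (∏ j, a j) ∧
    (∑ j, a j ^ 3) / 3 = -(∏ j, a j) * conj ((∑ j, a j ^ 2) / 2) := by
  have hconj : ∀ j, conj (a j) = (a j)⁻¹ := fun j => eq_inv_of_mul_eq_one_right (ha j)
  have hne : ∀ j, a j ≠ 0 := fun j h => by simpa [h] using ha j
  have h1c : ∑ j, (a j)⁻¹ = 0 := by simp only [← hconj, ← map_sum, h1, map_zero]
  have n0 := hne 0
  have n1 := hne 1
  have n2 := hne 2
  have n3 := hne 3
  have n4 := hne 4
  simp only [Fin.sum_univ_five, Fin.prod_univ_five, map_div₀, map_add, map_pow, hconj,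
    map_ofNat] at *
  generalize a 0 = x0 at *
  generalize a 1 = x1 at *
  generalize a 2 = x2 at *
  generalize a 3 = x3 at *
  generalize a 4 = x4 at *
  have e2 : x0 * x1 + x0 * x2 + x0 * x3 + x0 * x4 + x1 * x2 + x1 * x3 + x1 * x4 + x2 * x3 +
      x2 * x4 + x3 * x4 = -((x0 ^ 2 + x1 ^ 2 + x2 ^ 2 + x3 ^ 2 + x4 ^ 2) / 2) := by
    linear_combination (x0 + x1 + x2 + x3 + x4) / 2 * h1
  have e2c : x0⁻¹ * x1⁻¹ + x0⁻¹ * x2⁻¹ + x0⁻¹ * x3⁻¹ + x0⁻¹ * x4⁻¹ + x1⁻¹ * x2⁻¹ + x1⁻¹ * x3⁻¹ +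
      x1⁻¹ * x4⁻¹ + x2⁻¹ * x3⁻¹ + x2⁻¹ * x4⁻¹ + x3⁻¹ * x4⁻¹ =
      -((x0⁻¹ ^ 2 + x1⁻¹ ^ 2 + x2⁻¹ ^ 2 + x3⁻¹ ^ 2 + x4⁻¹ ^ 2) / 2) := by
    linear_combination (x0⁻¹ + x1⁻¹ + x2⁻¹ + x3⁻¹ + x4⁻¹) / 2 * h1c
  have e4 : x0 * x1 * x2 * x3 + x0 * x1 * x2 * x4 + x0 * x1 * x3 * x4 + x0 * x2 * x3 * x4 +
      x1 * x2 * x3 * x4 = 0 := by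
    have : x0 * x1 * x2 * x3 + x0 * x1 * x2 * x4 + x0 * x1 * x3 * x4 + x0 * x2 * x3 * x4 +
      x1 * x2 * x3 * x4 = x0 * x1 * x2 * x3 * x4 * (x0⁻¹ + x1⁻¹ + x2⁻¹ + x3⁻¹ + x4⁻¹) := by
      field_simp; ring
    rw [this, h1c, mul_zero]
  have e3 : x0 * x1 * x2 + x0 * x1 * x3 + x0 * x1 * x4 + x0 * x2 * x3 + x0 * x2 * x4 +
      x0 * x3 * x4 + x1 * x2 * x3 + x1 * x2 * x4 + x1 * x3 * x4 + x2 * x3 * x4 =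
      (x0 ^ 3 + x1 ^ 3 + x2 ^ 3 + x3 ^ 3 + x4 ^ 3) / 3 := by
    linear_combination (-(x0 + x1 + x2 + x3 + x4) ^ 2 / 3 + (x0 * x1 + x0 * x2 + x0 * x3 + x0 * x4 +
      x1 * x2 + x1 * x3 + x1 * x4 + x2 * x3 + x2 * x4 + x3 * x4)) * h1
  have e3c : x0 * x1 * x2 + x0 * x1 * x3 + x0 * x1 * x4 + x0 * x2 * x3 + x0 * x2 * x4 +
      x0 * x3 * x4 + x1 * x2 * x3 + x1 * x2 * x4 + x1 * x3 * x4 + x2 * x3 * x4 =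
      x0 * x1 * x2 * x3 * x4 * (x0⁻¹ * x1⁻¹ + x0⁻¹ * x2⁻¹ + x0⁻¹ * x3⁻¹ + x0⁻¹ * x4⁻¹ +
        x1⁻¹ * x2⁻¹ + x1⁻¹ * x3⁻¹ + x1⁻¹ * x4⁻¹ + x2⁻¹ * x3⁻¹ + x2⁻¹ * x4⁻¹ + x3⁻¹ * x4⁻¹) := by
    field_simp; ring
  refine ⟨?_, ?_⟩
  · have E1 := congrArg (C : ℂ → ℂ[X]) h1
    have E2 := congrArg (C : ℂ → ℂ[X]) e2
    have E3 := congrArg (C : ℂ → ℂ[X]) e3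
    have E4 := congrArg (C : ℂ → ℂ[X]) e4
    rw [map_neg] at E2
    rw [← e3, ← neg_neg ((x0 ^ 2 + x1 ^ 2 + x2 ^ 2 + x3 ^ 2 + x4 ^ 2) / 2), ← e2]
    simp only [map_add, map_mul, map_zero, map_neg] at E1 E4 ⊢
    linear_combination -X ^ 4 * E1 + X * E4
  · rw [← e3, e3c, e2c]
    ring

-- With `m = -2 w / s` one gets `s = -m ^ 2 / 2` and `w = m ^ 3 / 4`, and the polynomial with roots
-- `a j` becomes `(X - m) (X ^ 2 + m X / 2 + m ^ 2) ^ 2`.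
open ComplexConjugate Polynomial in
theorem eq_or_quadratic_of_power_sums {a : Fin 5 → ℂ} (ha : ∀ j, a j * conj (a j) = 1)
    (h1 : ∑ j, a j = 0) {s w : ℂ} (h2 : ∑ j, a j ^ 2 = 5 * s) (h3 : ∑ j, a j ^ 3 = 15 * w)
    (hsw : s ^ 3 = -2 * w ^ 2) (hs : Complex.normSq s = 1 / 4) :
    ∃ m ≠ 0, ∀ j, a j = m ∨ a j ^ 2 + m * a j / 2 + m ^ 2 = 0 := by
  obtain ⟨hp, h5⟩ := prod_X_sub_C_of_sum_eq_zero ha h1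
  rw [h2, h3] at hp h5
  have hss : s * conj s = 1 / 4 := by rw [Complex.mul_conj, hs]; norm_num
  have hs0 : s ≠ 0 := by rintro rfl; norm_num at hs
  have hw0 : w ≠ 0 := by
    rintro rfl
    exact hs0 (pow_eq_zero_iff (n := 3) (by norm_num) |>.1 (by simpa using hsw))
  have he5 : ∏ j, a j = -8 * s * w := by
    simp only [map_div₀, map_mul, map_ofNat] at h5
    linear_combination (8 * s / 5) * h5 - 4 * (∏ j, a j) * hss
  refine ⟨-2 * w / s, by simp [hs0, hw0], fun j => ?_⟩
  obtain ⟨m, hm⟩ : ∃ m, m = -2 * w / s := ⟨_, rfl⟩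
  rw [← hm]
  have hm1 : m * s = -2 * w := by rw [hm]; field_simp
  have hm2 : m ^ 2 = -2 * s := by
    have : s ^ 2 * m ^ 2 = s ^ 2 * (-2 * s) := by linear_combination (m * s - 2 * w) * hm1 + 2 * hsw
    exact mul_left_cancel₀ (pow_ne_zero 2 hs0) this
  have hroot := congrArg (Polynomial.eval (a j)) hp
  rw [Polynomial.eval_prod, Finset.prod_eq_zero (Finset.mem_univ j) (by simp), he5] at hroot
  simp at hroot
  have : (a j - m) * (a j ^ 2 + m * a j / 2 + m ^ 2) ^ 2 = 0 := by
    have hw : w = m ^ 3 / 4 := by linear_combination (-m / 4) * hm2 + (1 / 2) * hm1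
    have hs' : s = -m ^ 2 / 2 := by linear_combination hm2 / 2
    rw [hw, hs'] at hroot
    linear_combination -hroot
  rcases mul_eq_zero.1 this with h | h
  · exact Or.inl (sub_eq_zero.1 h)
  · exact Or.inr (pow_eq_zero_iff two_ne_zero |>.1 h)

/-- A family of five numbers taken from `m`, `m ω`, `m ω'` with zero sum, where `ω, ω'` are the roots of
`X ^ 2 + X / 2 + 1`, takes these values `1`, `2` and `2` times. -/
theorem exists_pairs_of_eq_or_quadratic {a : Fin 5 → ℂ} {m : ℂ} (hm : m ≠ 0) (h1 : ∑ j, a j = 0)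
    (h : ∀ j, a j = m ∨ a j ^ 2 + m * a j / 2 + m ^ 2 = 0) :
    ∃ o b c d e : Fin 5, b ≠ c ∧ (∀ F : Fin 5 → ℂ, ∑ j, F j = F o + (F b + F c) + (F d + F e)) ∧
      a b = a c ∧ a d = a e ∧ a b ≠ a d := by
  have h15 : (0 : ℝ) < √15 := by positivity
  have hsq : √15 * √15 = 15 := Real.mul_self_sqrt (by norm_num)
  have hv : ∀ j, ∃ k : Fin 3, a j = m * (![1, ⟨-1 / 4, √15 / 4⟩, ⟨-1 / 4, -√15 / 4⟩] k : ℂ) := by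
    intro j
    rcases h j with h | h
    · exact ⟨0, by simp [h]⟩
    · have hf : (a j - m * ⟨-1 / 4, √15 / 4⟩) * (a j - m * ⟨-1 / 4, -√15 / 4⟩) = 0 := by
        have e1 : (⟨-1 / 4, √15 / 4⟩ + ⟨-1 / 4, -√15 / 4⟩ : ℂ) = -1 / 2 := by
          apply Complex.ext
          · simp; norm_num
          · simp; ring
        have e2 : (⟨-1 / 4, √15 / 4⟩ * ⟨-1 / 4, -√15 / 4⟩ : ℂ) = 1 := by
          apply Complex.ext
          · simp; linear_combination hsq / 16
          · simp; ring
        linear_combination h - a j * m * e1 + m ^ 2 * e2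
      rcases mul_eq_zero.1 hf with h | h
      · exact ⟨1, by simpa using sub_eq_zero.1 h⟩
      · exact ⟨2, by simpa using sub_eq_zero.1 h⟩
  choose g hg using hv
  have hfib : ∀ F : Fin 5 → ℂ, ∑ j, F j = ∑ j with g j = 0, F j + ∑ j with g j = 1, F j +
      ∑ j with g j = 2, F j := fun F => by
    rw [← Finset.sum_fiberwise Finset.univ g F, Fin.sum_univ_three]
  have hcard := hfib fun _ => 1
  have hsum := hfib a
  have hconst : ∀ k, ∑ j with g j = k, a j = (Finset.card {j | g j = k} : ℂ) *
      (m * (![1, ⟨-1 / 4, √15 / 4⟩, ⟨-1 / 4, -√15 / 4⟩] k : ℂ)) := fun k => by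
    rw [← nsmul_eq_mul, ← Finset.sum_const]
    refine Finset.sum_congr rfl fun j hj => ?_
    rw [hg j, (Finset.mem_filter.1 hj).2]
  rw [h1, hconst, hconst, hconst] at hsum
  simp only [Finset.sum_const, nsmul_eq_mul, mul_one, Finset.card_univ, Fintype.card_fin] at hcard
  generalize hS0 : ({j | g j = 0} : Finset (Fin 5)) = S0 at *
  generalize hS1 : ({j | g j = 1} : Finset (Fin 5)) = S1 at *
  generalize hS2 : ({j | g j = 2} : Finset (Fin 5)) = S2 at *
  have hcard' : 5 = S0.card + S1.card + S2.card := by exact_mod_cast hcard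
  have hsum' : (S0.card + S1.card * ⟨-1 / 4, √15 / 4⟩ + S2.card * ⟨-1 / 4, -√15 / 4⟩ : ℂ) = 0 := by
    refine mul_left_cancel₀ hm ?_
    simp at hsum
    linear_combination -hsum
  have hre := congrArg Complex.re hsum'
  have him := congrArg Complex.im hsum'
  simp at hre him
  -- The imaginary part of the zero sum gives `n1 = n2`, the real part `4 n0 = n1 + n2`; with total
  -- `5` this leaves only `1, 2, 2`.
  have k12 : (S1.card : ℝ) = S2.card := by
    have : √15 * ((S1.card : ℝ) - S2.card) = 0 := by linear_combination 4 * him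
    rcases mul_eq_zero.1 this with h | h <;> linarith
  have k0 : (4 * S0.card : ℝ) = S1.card + S2.card := by linarith
  have k12' : S1.card = S2.card := by exact_mod_cast k12
  have k0' : 4 * S0.card = S1.card + S2.card := by exact_mod_cast k0
  obtain ⟨o, ho⟩ := Finset.card_eq_one.1 (show S0.card = 1 by omega)
  obtain ⟨b, c, hbc, hb⟩ := Finset.card_eq_two.1 (show S1.card = 2 by omega)
  obtain ⟨d, e, hde, hd⟩ := Finset.card_eq_two.1 (show S2.card = 2 by omega)
  have gb : g b = 1 := by have : b ∈ S1 := by simp [hb]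
                          simpa [← hS1] using this
  have gc : g c = 1 := by have : c ∈ S1 := by simp [hb]
                          simpa [← hS1] using this
  have gd : g d = 2 := by have : d ∈ S2 := by simp [hd]
                          simpa [← hS2] using this
  have ge : g e = 2 := by have : e ∈ S2 := by simp [hd]
                          simpa [← hS2] using this
  refine ⟨o, b, c, d, e, hbc, fun F => ?_, by rw [hg b, hg c, gb, gc], by rw [hg d, hg e, gd, ge],
    fun hbd => ?_⟩
  · rw [hfib, ho, hb, hd, Finset.sum_singleton, Finset.sum_pair hbc, Finset.sum_pair hde]
  · rw [hg b, hg d, gb, gd] at hbd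
    have := congrArg Complex.im (mul_left_cancel₀ hm hbd)
    simp at this
    linarith

/-! ### The squares of row ratios sum to zero -/

/-- Five unit complex numbers of zero sum, two of them `1`, cannot have three equal real parts. -/
theorem false_of_re_eq {z : Fin 5 → ℂ} (hz : ∀ i, Complex.normSq (z i) = 1) (h : ∑ i, z i = 0)
    (h0 : z 0 = 1) (h1 : z 1 = 1) (h23 : (z 2).re = (z 3).re) (h24 : (z 2).re = (z 4).re) :
    False := by
  have hr := congrArg Complex.re h
  have hi := congrArg Complex.im h
  have n2 := hz 2
  have n3 := hz 3
  have n4 := hz 4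
  rw [Complex.normSq_apply] at n2 n3 n4
  simp only [Fin.sum_univ_five, h0, h1, Complex.add_re, Complex.add_im, Complex.one_re,
    Complex.one_im, Complex.zero_re, Complex.zero_im, ← h23, ← h24] at hr hi n3 n4
  have hre : (z 2).re = -2 / 3 := by linarith
  rw [hre] at n2 n3 n4
  have s3 : (z 3).im = (z 2).im ∨ (z 3).im = -(z 2).im := sq_eq_sq_iff_eq_or_eq_neg.1 (by linarith)
  have s4 : (z 4).im = (z 2).im ∨ (z 4).im = -(z 2).im := sq_eq_sq_iff_eq_or_eq_neg.1 (by linarith)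
  have : (z 2).im = 0 := by rcases s3 with s3 | s3 <;> rcases s4 with s4 | s4 <;> linarith
  rw [this] at n2
  norm_num at n2

open ComplexConjugate Matrix in
theorem sum_row_sq_eq_zero {H : Matrix (Fin 5) (Fin 5) ℂ} (hn : ∀ i j, H i j * conj (H i j) = 1)
    (h1 : H * Hᴴ = (5 : ℂ) • 1) (h2 : Hᴴ * H = (5 : ℂ) • 1) (h0 : ∀ j, H 0 j = 1) :
    ∑ j, H 1 j ^ 2 = 0 := by
  by_contra hne
  have hconj : ∀ j, conj (H 1 j) * H 1 j = 1 := fun j => by rw [mul_comm, hn]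
  have R : ∀ i k, ∑ j, H i j * conj (H k j) = if i = k then 5 else 0 := fun i k => by
    have := congrFun (congrFun h1 i) k
    simpa [Matrix.mul_apply, Matrix.one_apply] using this
  have hDD : diagonal (H 1) * (diagonal (H 1))ᴴ = 1 := by
    rw [diagonal_conjTranspose, diagonal_mul_diagonal, ← diagonal_one]
    congr 1; ext j; simpa using hn 1 j
  have hDD' : (diagonal (H 1))ᴴ * diagonal (H 1) = 1 := by
    rw [diagonal_conjTranspose, diagonal_mul_diagonal, ← diagonal_one]
    congr 1; ext j; simpa using hconj j
  -- `E` is conjugation by the unitary `H / √5`. As the entries of `H` are unimodular, it sends a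
  -- diagonal matrix to one whose diagonal is constant, equal to the mean.
  obtain ⟨E, hE⟩ : ∃ E : Matrix (Fin 5) (Fin 5) ℂ → Matrix (Fin 5) (Fin 5) ℂ,
    E = fun D => (1 / 5 : ℂ) • (H * D * Hᴴ) := ⟨_, rfl⟩
  have hmul : ∀ D D', E D * E D' = E (D * D') := fun D D' => by
    simp only [hE, Matrix.smul_mul, Matrix.mul_smul, smul_smul]
    rw [show H * D * Hᴴ * (H * D' * Hᴴ) = H * D * (Hᴴ * H) * D' * Hᴴ by
      simp only [Matrix.mul_assoc], h2]
    simp only [Matrix.smul_mul, Matrix.mul_smul, smul_smul, Matrix.mul_one, ← Matrix.mul_assoc]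
    norm_num
  have hone : E 1 = 1 := by
    simp only [hE, Matrix.mul_one, h1, smul_smul]; norm_num
  have hstar : ∀ D, (E D)ᴴ = E Dᴴ := fun D => by
    simp [hE, conjTranspose_smul, conjTranspose_mul, Matrix.mul_assoc]
  have happ : ∀ v i k, E (diagonal v) i k = (∑ j, H i j * v j * conj (H k j)) / 5 := fun v i k => by
    simp only [hE, Matrix.smul_apply, smul_eq_mul]
    rw [Matrix.mul_apply, one_div_mul_eq_div]
    simp only [Matrix.mul_diagonal, conjTranspose_apply]
    rfl
  have hdiag : ∀ v i, E (diagonal v) i i = (∑ j, v j) / 5 := fun v i => by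
    rw [happ]; congr 1
    exact Finset.sum_congr rfl fun j _ => by linear_combination v j * hn i j
  have hsum1 : ∑ j, H 1 j = 0 := by simpa [h0] using R 1 0
  have hsq : ∀ i, (E (diagonal (H 1)) * E (diagonal (H 1))) i i = (∑ j, H 1 j ^ 2) / 5 := fun i => by
    rw [hmul, diagonal_mul_diagonal, hdiag]; simp only [sq]
  have hcu : ∀ i, (E (diagonal (H 1)) * E (diagonal (H 1)) * E (diagonal (H 1))) i i =
      (∑ j, H 1 j ^ 3) / 5 := fun i => by
    rw [hmul, hmul, diagonal_mul_diagonal, diagonal_mul_diagonal, hdiag]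
    congr 1; exact Finset.sum_congr rfl fun j _ => by ring
  obtain ⟨w, hw, hsw, hs⟩ := shift_relation (M := E (diagonal (H 1)))
    (by rw [hstar, hmul, hDD, hone]) (by rw [hstar, hmul, hDD', hone])
    (fun i => by rw [hdiag, hsum1, zero_div])
    (by rw [happ]; simp only [h0, one_mul, hn]; norm_num)
    (fun i => by rw [hsq, hsq]) (fun i => by rw [hcu, hcu])
    (by rw [hsq]; exact div_ne_zero hne (by norm_num))
  rw [hcu] at hw
  rw [hsq] at hsw hs
  obtain ⟨m, hm, hroot⟩ := eq_or_quadratic_of_power_sums (hn 1) hsum1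
    (s := (∑ j, H 1 j ^ 2) / 5) (w := w) (by ring) (by linear_combination 5 * hw) hsw hs
  obtain ⟨o, b, c, d, e, hbc, hF, ebc, ede, ebd⟩ := exists_pairs_of_eq_or_quadratic hm hsum1 hroot
  -- Orthogonality to rows `0` and `1` eliminates columns `d` and `e`, so `|H i b + H i c|` is the
  -- same for every `i ≥ 2`.
  have hB : ∀ i, i ≠ 0 → i ≠ 1 → Complex.normSq (H i b + H i c) * Complex.normSq (H 1 b - H 1 d) =
      Complex.normSq (H 1 d - H 1 o) := fun i i0 i1 => by
    have f0 := R i 0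
    have f1 := R i 1
    rw [hF] at f0 f1
    simp only [h0, map_one, mul_one, if_neg i0, if_neg i1, ← ebc, ← ede] at f0 f1
    have : (H i b + H i c) * conj (H 1 b - H 1 d) = H i o * conj (H 1 d - H 1 o) := by
      simp only [map_sub]
      linear_combination f1 - conj (H 1 d) * f0
    have hio : Complex.normSq (H i o) = 1 := by
      have := hn i o
      rw [Complex.mul_conj] at this
      exact_mod_cast this
    rw [← Complex.normSq_conj (H 1 b - H 1 d), ← Complex.normSq_mul, this, Complex.normSq_mul, hio,
      Complex.normSq_conj, one_mul]
  have hbd0 : Complex.normSq (H 1 b - H 1 d) ≠ 0 := by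
    simpa [sub_eq_zero] using ebd
  have hns : ∀ i j, Complex.normSq (H i j) = 1 := fun i j => by
    have := hn i j
    rw [Complex.mul_conj] at this
    exact_mod_cast this
  have hre : ∀ i, i ≠ 0 → i ≠ 1 → (H 2 b * conj (H 2 c)).re = (H i b * conj (H i c)).re :=
      fun i i0 i1 => by
    have e := mul_right_cancel₀ hbd0 ((hB 2 (by decide) (by decide)).trans (hB i i0 i1).symm)
    rw [Complex.normSq_add, Complex.normSq_add, hns, hns, hns, hns] at e
    linarith
  refine false_of_re_eq (z := fun i => H i b * conj (H i c)) (fun i => ?_) ?_ ?_ ?_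
    (hre 3 (by decide) (by decide)) (hre 4 (by decide) (by decide))
  · rw [Complex.normSq_mul, Complex.normSq_conj, hns, hns, one_mul]
  · have := congrFun (congrFun h2 c) b
    simp only [Matrix.mul_apply, conjTranspose_apply, Matrix.smul_apply,
      Matrix.one_apply_ne hbc.symm, smul_zero] at this
    rw [← this]
    exact Finset.sum_congr rfl fun j _ => mul_comm _ _
  · simp [h0]
  · simp only [ebc]; exact hn 1 c

open ComplexConjugate Matrix in
/-- The squares of the entrywise ratio of two rows of a complex Hadamard matrix of order `5` sum to zero. -/
theorem sum_ratio_sq_eq_zero {H : Matrix (Fin 5) (Fin 5) ℂ}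
    (hn : ∀ i j, H i j * conj (H i j) = 1)
    (h1 : H * Hᴴ = (5 : ℂ) • 1) (h2 : Hᴴ * H = (5 : ℂ) • 1) {i k : Fin 5} (hik : i ≠ k) :
    ∑ j, (H i j * conj (H k j)) ^ 2 = 0 := by
  obtain ⟨σ, σ0, σ1⟩ : ∃ σ : Equiv.Perm (Fin 5), σ 0 = k ∧ σ 1 = i := by
    refine ⟨(Equiv.swap 0 k).trans (Equiv.swap (Equiv.swap 0 k 1) i), ?_, by simp⟩
    rw [Equiv.trans_apply, Equiv.swap_apply_left]
    refine Equiv.swap_apply_of_ne_of_ne (fun h => ?_) hik.symm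
    have := (Equiv.swap (0 : Fin 5) k).injective (by rw [← h, Equiv.swap_apply_left] :
      Equiv.swap 0 k 1 = Equiv.swap 0 k 0)
    exact absurd this (by decide)
  have hDD : diagonal (fun j => conj (H k j)) * (diagonal fun j => conj (H k j))ᴴ = 1 := by
    rw [diagonal_conjTranspose, diagonal_mul_diagonal, ← diagonal_one]
    congr 1; ext j; simpa [mul_comm] using hn k j
  have hDD' : (diagonal fun j => conj (H k j))ᴴ * diagonal (fun j => conj (H k j)) = 1 := by
    rw [diagonal_conjTranspose, diagonal_mul_diagonal, ← diagonal_one]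
    congr 1; ext j; simpa using hn k j
  -- Rows `k` and `i` move to `0` and `1`, and dividing each column by its entry in row `k` makes
  -- row `0` constant.
  have := sum_row_sq_eq_zero (H := H.submatrix σ id * diagonal fun j => conj (H k j)) ?_ ?_ ?_ ?_
  · simpa [mul_diagonal, σ1] using this
  · intro a b
    simp only [mul_diagonal, submatrix_apply, id, map_mul, Complex.conj_conj]
    linear_combination (H k b * conj (H k b)) * hn (σ a) b + hn k b
  · rw [conjTranspose_mul, Matrix.mul_assoc, ← Matrix.mul_assoc (diagonal _), hDD, Matrix.one_mul,
      conjTranspose_submatrix, ← submatrix_mul _ _ _ _ _ Function.bijective_id, h1]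
    ext a b
    simp [Matrix.one_apply]
  · rw [conjTranspose_mul, Matrix.mul_assoc, ← Matrix.mul_assoc _ (submatrix _ _ _),
      conjTranspose_submatrix, ← submatrix_mul _ _ _ _ _ σ.bijective, h2]
    simp only [submatrix_smul, Pi.smul_apply, submatrix_one _ Function.injective_id]
    rw [Matrix.smul_mul, Matrix.one_mul, Matrix.mul_smul, hDD']
  · intro j
    simp [mul_diagonal, σ0, hn]

/-! ### Entries as fifth roots of unity -/

open ComplexConjugate Polynomial in
/-- Five unit complex numbers whose sum and sum of squares vanish form a regular pentagon. -/
theorem pow_five_eq_and_injective {a : Fin 5 → ℂ} (ha : ∀ j, a j * conj (a j) = 1)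
    (h1 : ∑ j, a j = 0) (h2 : ∑ j, a j ^ 2 = 0) :
    (∀ j k, a j ^ 5 = a k ^ 5) ∧ Function.Injective a := by
  obtain ⟨hp, h3⟩ := prod_X_sub_C_of_sum_eq_zero ha h1
  rw [h3, h2] at hp
  simp only [zero_div, map_zero, mul_zero, zero_mul, sub_zero] at hp
  have hne : ∀ j, a j ≠ 0 := fun j h => by simpa [h] using ha j
  have hj : ∀ j, a j ^ 5 = ∏ j, a j := fun j => by
    have hroot := congrArg (Polynomial.eval (a j)) hp
    rw [Polynomial.eval_prod, Finset.prod_eq_zero (Finset.mem_univ j) (by simp)] at hroot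
    simp only [eval_sub, eval_pow, eval_X, eval_C] at hroot
    exact (sub_eq_zero.1 hroot.symm)
  refine ⟨fun j k => (hj j).trans (hj k).symm, ?_⟩
  rw [← separable_prod_X_sub_C_iff, hp]
  exact separable_X_pow_sub_C _ (by norm_num) (Finset.prod_ne_zero_iff.2 fun j _ => hne j)

theorem isPrimitiveRoot_stdAddChar_one : IsPrimitiveRoot (ZMod.stdAddChar (1 : ZMod 5)) 5 := by
  have := ZMod.stdAddChar_coe (N := 5) 1
  rw [Int.cast_one] at this
  rw [this]
  convert Complex.isPrimitiveRoot_exp 5 (by norm_num) using 2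
  push_cast; ring

theorem exists_stdAddChar_eq {z : ℂ} (hz : z ^ 5 = 1) : ∃ k : ZMod 5, z = ZMod.stdAddChar k := by
  obtain ⟨i, -, hi⟩ := isPrimitiveRoot_stdAddChar_one.eq_pow_of_pow_eq_one hz
  exact ⟨(i : ZMod 5), by rw [← hi, ← AddChar.map_nsmul_eq_pow, nsmul_one]⟩

open ComplexConjugate Matrix in
theorem exists_exponents {H : Matrix (Fin 5) (Fin 5) ℂ} (hn : ∀ i j, H i j * conj (H i j) = 1)
    (h1 : H * Hᴴ = (5 : ℂ) • 1) (h2 : Hᴴ * H = (5 : ℂ) • 1) (h0 : ∀ j, H 0 j = 1)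
    (h0' : ∀ i, H i 0 = 1) :
    ∃ f : Fin 5 → Fin 5 → ZMod 5, (∀ i j, H i j = ZMod.stdAddChar (f i j)) ∧ (∀ j, f 0 j = 0) ∧
      (∀ i, f i 0 = 0) ∧ ∀ i k, i ≠ k → Function.Injective fun j => f i j - f k j := by
  have key : ∀ i k, i ≠ k → _ := fun i k hik =>
    pow_five_eq_and_injective (a := fun j => H i j * conj (H k j)) (fun j => by
      rw [map_mul, Complex.conj_conj]
      linear_combination (H k j * conj (H k j)) * hn i j + hn k j) (by
      have := congrFun (congrFun h1 i) k
      simpa [Matrix.mul_apply, Matrix.one_apply, hik] using this) (sum_ratio_sq_eq_zero hn h1 h2 hik)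
  have hex : ∀ i j, ∃ k : ZMod 5, H i j = ZMod.stdAddChar k := fun i j => by
    by_cases hi : i = 0
    · exact ⟨0, by simp [hi, h0]⟩
    · refine exists_stdAddChar_eq ?_
      have := (key i 0 hi).1 j 0
      simpa [h0, h0'] using this
  choose f hf using hex
  refine ⟨f, hf, fun j => ?_, fun i => ?_, fun i k hik j j' hjj => ?_⟩
  · apply ZMod.injective_stdAddChar
    rw [← hf, h0, AddChar.map_zero_eq_one]
  · apply ZMod.injective_stdAddChar
    rw [← hf, h0', AddChar.map_zero_eq_one]
  · refine (key i k hik).2 ?_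
    have hinv : ∀ l, conj (H k l) = ZMod.stdAddChar (-f k l) := fun l => by
      rw [eq_inv_of_mul_eq_one_right (hn k l), hf, AddChar.map_neg_eq_inv]
    simp only [hinv]; simp only [hf]
    rw [← AddChar.map_add_eq_mul, ← AddChar.map_add_eq_mul, ← sub_eq_add_neg, ← sub_eq_add_neg]
    exact congrArg _ hjj

/-! ### Permutations of `ZMod 5` fixing `0` -/

-- A finite check over pairs of the `24` permutations of `Fin 5` fixing `0`, whose arithmetic is
-- that of `ZMod 5`. Listing values with nested distinctness conditions keeps the enumeration small.
set_option synthInstance.maxSize 10000 in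
set_option synthInstance.maxHeartbeats 400000 in
theorem fin_perm_equiv_of_card_eq : ∀ b : Fin 5, b ≠ 0 → ∀ c : Fin 5, c ≠ 0 ∧ c ≠ b →
    ∀ d : Fin 5, d ≠ 0 ∧ d ≠ b ∧ d ≠ c → ∀ e : Fin 5, e ≠ 0 ∧ e ≠ b ∧ e ≠ c ∧ e ≠ d →
    ∀ b' : Fin 5, b' ≠ 0 → ∀ c' : Fin 5, c' ≠ 0 ∧ c' ≠ b' →
    ∀ d' : Fin 5, d' ≠ 0 ∧ d' ≠ b' ∧ d' ≠ c' →
    ∀ e' : Fin 5, e' ≠ 0 ∧ e' ≠ b' ∧ e' ≠ c' ∧ e' ≠ d' →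
    (∀ k : Fin 5, Finset.card {x : Fin 5 | x * ![0, b, c, d, e] x = k} =
      Finset.card {x : Fin 5 | x * ![0, b', c', d', e'] x = k}) →
    ∃ a : Fin 5, a ≠ 0 ∧ ((∀ x : Fin 5, a * ![0, b', c', d', e'] (a * x) = ![0, b, c, d, e] x) ∨
      ∀ x : Fin 5, ![0, b, c, d, e] (a * ![0, b', c', d', e'] (a * x)) = x) := by
  decide +kernel

set_option synthInstance.maxSize 10000 in
theorem fin_perm_linear_of_sub_injective : ∀ b : Fin 5, b ≠ 0 → ∀ c : Fin 5, c ≠ 0 ∧ c ≠ b →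
    ∀ d : Fin 5, d ≠ 0 ∧ d ≠ b ∧ d ≠ c → ∀ e : Fin 5, e ≠ 0 ∧ e ≠ b ∧ e ≠ c ∧ e ≠ d →
    (Function.Injective fun x : Fin 5 => ![0, b, c, d, e] x - x) →
    ∀ x : Fin 5, ![0, b, c, d, e] x = b * x := by
  decide +kernel

theorem eq_vec_and_ne {u : Fin 5 → Fin 5} (h0 : u 0 = 0) (hu : Function.Injective u) :
    u = ![0, u 1, u 2, u 3, u 4] ∧ u 1 ≠ 0 ∧ (u 2 ≠ 0 ∧ u 2 ≠ u 1) ∧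
      (u 3 ≠ 0 ∧ u 3 ≠ u 1 ∧ u 3 ≠ u 2) ∧ (u 4 ≠ 0 ∧ u 4 ≠ u 1 ∧ u 4 ≠ u 2 ∧ u 4 ≠ u 3) := by
  refine ⟨?_, ?_⟩
  · ext x; fin_cases x <;> simp [h0]
  · rw [← h0]
    simp only [ne_eq, hu.eq_iff]
    decide

/-- Permutations of `ZMod 5` fixing `0` for which `x * u x` is equidistributed agree up to
dilation and inversion. -/
theorem perm_equiv_of_card_eq {u v : ZMod 5 → ZMod 5} (hu0 : u 0 = 0) (hu : Function.Injective u)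
    (hv0 : v 0 = 0) (hv : Function.Injective v)
    (h : ∀ k, Finset.card {x | x * u x = k} = Finset.card {x | x * v x = k}) :
    ∃ a ≠ 0, (∀ x, a * v (a * x) = u x) ∨ ∀ x, u (a * v (a * x)) = x := by
  obtain ⟨eu, u1, u2, u3, u4⟩ := eq_vec_and_ne (u := u) hu0 hu
  obtain ⟨ev, v1, v2, v3, v4⟩ := eq_vec_and_ne (u := v) hv0 hv
  have := fin_perm_equiv_of_card_eq _ u1 _ u2 _ u3 _ u4 _ v1 _ v2 _ v3 _ v4
  rw [← eu, ← ev] at this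
  exact this h

theorem linear_of_sub_injective {u : ZMod 5 → ZMod 5} (hu0 : u 0 = 0) (hu : Function.Injective u)
    (h : Function.Injective fun x => u x - x) (x : ZMod 5) : u x = u 1 * x := by
  obtain ⟨eu, u1, u2, u3, u4⟩ := eq_vec_and_ne (u := u) hu0 hu
  have := fin_perm_linear_of_sub_injective _ u1 _ u2 _ u3 _ u4
  rw [← eu] at this
  exact this h x

/-- An integer relation among the fifth roots of unity has all coefficients equal. The differences
of the counts form such a relation, and they sum to `5 - 5 = 0`. -/
theorem card_eq_of_sum_stdAddChar_eq {u v : ZMod 5 → ZMod 5}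
    (h : ∑ x, ZMod.stdAddChar (u x) = ∑ x, ZMod.stdAddChar (v x)) (k : ZMod 5) :
    Finset.card {x | u x = k} = Finset.card {x | v x = k} := by
  have hs : ∀ u : ZMod 5 → ZMod 5, ∑ x, ZMod.stdAddChar (u x) =
      ∑ k : ZMod 5, (Finset.card {x | u x = k} : ℂ) * ZMod.stdAddChar k := fun u => by
    rw [← Finset.sum_fiberwise Finset.univ u]
    refine Finset.sum_congr rfl fun k _ => ?_
    rw [← nsmul_eq_mul, ← Finset.sum_const]
    exact Finset.sum_congr rfl fun j hj => by rw [(Finset.mem_filter.1 hj).2]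
  have hpow : ∀ k : Fin 5, (ZMod.stdAddChar (N := 5) k : ℂ) = ZMod.stdAddChar (1 : ZMod 5) ^ k.val :=
    fun k => by
      rw [← AddChar.map_nsmul_eq_pow, nsmul_one]
      congr 1
      exact (ZMod.natCast_zmod_val (n := 5) k).symm
  obtain ⟨α, hα⟩ : ∃ α : ZMod 5 → ℤ, ∀ k, α k = (Finset.card {x | u x = k} : ℤ) -
    (Finset.card {x | v x = k} : ℤ) := ⟨_, fun _ => rfl⟩
  have hz : ∑ k : ZMod 5, (α k : ℂ) * ZMod.stdAddChar k = 0 := by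
    rw [hs, hs] at h
    simp only [hα]
    push_cast
    simp only [sub_mul]
    rw [Finset.sum_sub_distrib]
    exact sub_eq_zero.2 h
  have heq : ∀ i j : ZMod 5, α i = α j :=
    (isPrimitiveRoot_stdAddChar_one.sum_eq_zero_iff_forall_eq_int (by norm_num) α).1
      ((Finset.sum_congr rfl fun k _ => by rw [hpow]).trans hz)
  have hc : ∀ u : ZMod 5 → ZMod 5, ∑ k : ZMod 5, (Finset.card {x | u x = k} : ℤ) = 5 := fun u => by
    have := Finset.card_eq_sum_card_fiberwise (f := u) (s := Finset.univ) (t := Finset.univ)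
      (fun x _ => Finset.mem_coe.2 (Finset.mem_univ _))
    rw [Finset.card_univ, ZMod.card] at this
    exact_mod_cast this.symm
  have hsum : ∑ l, α l = 0 := by
    simp only [hα]
    rw [Finset.sum_sub_distrib, hc, hc, sub_self]
  rw [Finset.sum_congr rfl fun l _ => heq l k, Finset.sum_const, Finset.card_univ, ZMod.card] at hsum
  have : (5 : ℤ) * α k = 0 := by simpa using hsum
  have := hα k
  omega

/-! ### Permuted Fourier matrices and their spectra -/

/-- The matrix `ψ (x * u y)` for the standard character `ψ` of `ZMod 5`. -/
noncomputable def permFourier (u : ZMod 5 → ZMod 5) : Matrix (ZMod 5) (ZMod 5) ℂ :=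
  Matrix.of fun x y => ((1 / √(5 : ℕ) : ℝ) : ℂ) * ZMod.stdAddChar (x * u y)

theorem Matrix.charpoly_eq_of_submatrix_eq {m n R : Type*} [Fintype m] [Fintype n] [DecidableEq m]
    [DecidableEq n] [CommRing R] {M : Matrix m m R} {N : Matrix n n R} (e : n ≃ m)
    (h : ∀ x y, N x y = M (e x) (e y)) : N.charpoly = M.charpoly := by
  rw [← Matrix.charpoly_reindex e N]
  congr 1
  ext x y
  simp [h]

theorem permFourier_charpoly_eq {u v : ZMod 5 → ZMod 5} (hu0 : u 0 = 0) (hu : Function.Injective u)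
    (hv0 : v 0 = 0) (hv : Function.Injective v)
    (h : (permFourier u).trace = (permFourier v).trace) :
    (permFourier u).charpoly = (permFourier v).charpoly := by
  have hc : ((1 / √(5 : ℕ) : ℝ) : ℂ) ≠ 0 := by
    rw [Complex.ofReal_ne_zero]; positivity
  have hsum : ∑ x, ZMod.stdAddChar (x * u x) = ∑ x, ZMod.stdAddChar (x * v x) := by
    refine mul_left_cancel₀ hc ?_
    simpa only [Matrix.trace, Matrix.diag, permFourier, Matrix.of_apply, ← Finset.mul_sum] using h
  obtain ⟨a, ha, h | h⟩ := perm_equiv_of_card_eq hu0 hu hv0 hv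
    (card_eq_of_sum_stdAddChar_eq (u := fun x => x * u x) (v := fun x => x * v x) hsum)
  · have : Fact (Nat.Prime 5) := ⟨by norm_num⟩
    refine Matrix.charpoly_eq_of_submatrix_eq (Equiv.mulLeft₀ a ha) fun x y => ?_
    simp only [permFourier, Matrix.of_apply, Equiv.mulLeft₀_apply, ← h]
    ring_nf
  · have : Fact (Nat.Prime 5) := ⟨by norm_num⟩
    have hinj : Function.Injective fun x => a * v (a * x) := fun x y hxy => by
      rw [← h x, ← h y]; exact congrArg u hxy
    let e : ZMod 5 ≃ ZMod 5 := Equiv.ofBijective _ (Finite.injective_iff_bijective.1 hinj)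
    have he : ∀ x, e x = a * v (a * x) := fun _ => rfl
    -- Here `e` is the inverse of `u`: relabelling the transpose by `e` gives exponents `x * e y =
    -- (a * x) * v (a * y)`, a dilate of the matrix of `v`.
    rw [← Matrix.charpoly_transpose (permFourier u)]
    refine Eq.trans ?_ (Matrix.charpoly_eq_of_submatrix_eq (Equiv.mulLeft₀ a ha)
      (N := Matrix.of fun x y => permFourier v (a * x) (a * y)) fun x y => rfl)
    refine (Matrix.charpoly_eq_of_submatrix_eq e fun x y => ?_).symm
    simp only [permFourier, Matrix.of_apply, Matrix.transpose_apply, he, h]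
    ring_nf

/-- Every dephased complex Hadamard matrix of order `5` is a permuted Fourier matrix, up to conjugation by a
permutation matrix. -/
theorem exists_permFourier {A : Matrix (Fin 5) (Fin 5) ℂ} (hA : IsHadamard A) (hA' : IsDephased A) :
    ∃ u : ZMod 5 → ZMod 5, u 0 = 0 ∧ Function.Injective u ∧ A.trace = (permFourier u).trace ∧
      A.charpoly = (permFourier u).charpoly := by
  obtain ⟨hA1, hA2, hA3⟩ := hA
  obtain ⟨hr, hc⟩ := hA'
  obtain ⟨c, hcdef⟩ : ∃ c : ℝ, c = √(5 : ℕ) := ⟨_, rfl⟩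
  have hcc : c * c = 5 := by rw [hcdef, Real.mul_self_sqrt] <;> norm_num
  have hccC : (c : ℂ) * c = 5 := by rw [← Complex.ofReal_mul, hcc]; norm_num
  have hc0 : c ≠ 0 := by rintro rfl; norm_num at hcc
  have hc0C : (c : ℂ) ≠ 0 := by exact_mod_cast hc0
  rw [← hcdef] at hA3 hr hc
  have hstar : ((c : ℂ) • A).conjTranspose = (c : ℂ) • A.conjTranspose := by
    rw [Matrix.conjTranspose_smul]; simp
  obtain ⟨f, hf, f0, f0', finj⟩ := exists_exponents (H := (c : ℂ) • A)
    (fun i j => by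
      rw [Matrix.smul_apply, smul_eq_mul, Complex.mul_conj, Complex.normSq_mul,
        Complex.normSq_ofReal, hcc, Complex.normSq_eq_norm_sq, hA3, div_pow, sq c, hcc]
      norm_num)
    (by rw [hstar, Matrix.smul_mul, Matrix.mul_smul, smul_smul, hccC, hA1])
    (by rw [hstar, Matrix.smul_mul, Matrix.mul_smul, smul_smul, hccC, hA2])
    (fun j => by simp [hr, hc0C]) (fun i => by simp [hc, hc0C])
  have hAf : ∀ i j, A i j = ((1 / √(5 : ℕ) : ℝ) : ℂ) * ZMod.stdAddChar (f i j) := fun i j => by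
    rw [← hf, ← hcdef, Matrix.smul_apply, smul_eq_mul]
    push_cast
    field_simp
  have hinj : ∀ i, i ≠ 0 → Function.Injective (f i) := fun i hi j j' h => by
    refine finj i 0 hi ?_
    simp only [f0, h]
  let τ : Fin 5 ≃ ZMod 5 := Equiv.ofBijective (f 1)
    ((Fintype.bijective_iff_injective_and_card _).2 ⟨hinj 1 (by decide), by simp⟩)
  have hτ : ∀ j, τ j = f 1 j := fun _ => rfl
  have hτ0 : τ.symm 0 = 0 := by rw [Equiv.symm_apply_eq, hτ, f0']
  obtain ⟨r, hr⟩ : ∃ r : Fin 5 → ZMod 5, ∀ i j, f i j = r i * τ j := by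
    have : ∀ i, ∃ r, ∀ j, f i j = r * τ j := fun i => by
      by_cases h0 : i = 0
      · exact ⟨0, fun j => by rw [h0, f0, zero_mul]⟩
      by_cases h1 : i = 1
      · exact ⟨1, fun j => by rw [h1, one_mul, hτ]⟩
      refine ⟨f i (τ.symm 1), fun j => ?_⟩
      -- In the coordinate `τ`, row `1` is the identity, so injectivity of row `i` minus row `1` is
      -- the hypothesis that forces linearity.
      have := linear_of_sub_injective (u := fun x => f i (τ.symm x)) (by rw [hτ0, f0'])
        ((hinj i h0).comp τ.symm.injective) (fun x y hxy => by
          refine τ.symm.injective (finj i 1 h1 ?_)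
          simpa only [← hτ, Equiv.apply_symm_apply] using hxy) (τ j)
      simpa using this
    choose r hr using this
    exact ⟨r, hr⟩
  have hrinj : Function.Injective r := fun i k hik => by
    by_contra hne
    have := finj i k hne (a₁ := 0) (a₂ := 1) (by simp only [hr, hik, sub_self])
    exact absurd this (by decide)
  let ρ : Fin 5 ≃ ZMod 5 := Equiv.ofBijective r
    ((Fintype.bijective_iff_injective_and_card _).2 ⟨hrinj, by simp⟩)
  have hρ : ∀ i, ρ i = r i := fun _ => rfl
  have hr0 : r 0 = 0 := by
    have := f0 (τ.symm 1)
    rwa [hr, Equiv.apply_symm_apply, mul_one] at this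
  have hentry : ∀ i j, A i j = permFourier (fun x => τ (ρ.symm x)) (ρ i) (ρ j) := fun i j => by
    rw [hAf, permFourier, Matrix.of_apply, Equiv.symm_apply_apply, hr, hρ]
  refine ⟨fun x => τ (ρ.symm x), ?_, τ.injective.comp ρ.symm.injective, ?_,
    Matrix.charpoly_eq_of_submatrix_eq ρ hentry⟩
  · have : ρ.symm 0 = 0 := by rw [Equiv.symm_apply_eq, hρ, hr0]
    simp only [this, hτ, f0']
  · simp only [Matrix.trace, Matrix.diag, hentry]
    exact Equiv.sum_comp ρ fun x => permFourier (fun x => τ (ρ.symm x)) x x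

theorem theorem3p2 (A B : Matrix (Fin 5) (Fin 5) ℂ)
    (hA : IsHadamard A) (hA' : IsDephased A) (hB : IsHadamard B) (hB' : IsDephased B)
    (htr : A.trace = B.trace) : SpectrallyEquivalent A B := by
  obtain ⟨u, hu0, hu, hut, huc⟩ := exists_permFourier hA hA'
  obtain ⟨v, hv0, hv, hvt, hvc⟩ := exists_permFourier hB hB'
  rw [SpectrallyEquivalent, huc, hvc,
    permFourier_charpoly_eq hu0 hu hv0 hv (by rw [← hut, ← hvt, htr])]
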